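/- Let $\mathfrak{G}$ be a (finite-dimensional, real) Lie group with Lie algebra $\mathfrak{g}$, let $\xi' \in \mathfrak{g}^*$ have a normal stabilizer $\mathfrak{G}_{\xi'} = \{a \in \mathfrak{G} : \mathrm{Ad}^*_a \xi' = \xi'\}$, and let $M$ be a nonempty smooth manifold. Let $O(\xi') = \{\mathrm{Ad}^*_a \xi' : a \in \mathfrak{G}\}$ be the co-adjoint orbit of $\xi'$, and let $\mathcal{G} = M \times O(\xi') \rightrightarrows M$ be the co-adjoint Lie groupoid whose source and target maps are both the projection to $M$ and whose multiplication is $(p, \mathrm{Ad}^*_a \xi')(p, \mathrm{Ad}^*_b \xi') = (p, \mathrm{Ad}^*_{ab} \xi')$. Its Lie algebroid is $A\mathcal{G} = M \times T_{\xi'}O(\xi')$, where $T_{\xi'}O(\xi') = \{\mathrm{ad}^*_V \xi' : V \in \mathfrak{g}\}$; the anchor $\rho'$ is the differential of the target map restricted to the kernel of the differential of the source map along the units, and the bracket of sections is computed pointwise from $[\mathrm{ad}^*_V \xi', \mathrm{ad}^*_W \xi'] = \mathrm{ad}^*_{[V,W]} \xi'$. The dual bundle $\tau : A^*\mathcal{G}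 = M \times T^*_{\xi'}O(\xi') \to M$ carries its linear Poisson structure, determined by $\{\hat X, \hat Y\} = -\widehat{[X,Y]}$, $\{l \circ \tau, \hat X\} = (\rho'(X) l) \circ \tau$ and $\{l \circ \tau, k \circ \tau\} = 0$ for sections $X, Y$ of $A\mathcal{G}$ and $l, k \in C^\infty(M)$, where $\hat X(\delta) = \delta(X(\tau(\delta)))$. The space $T^*_{\xi'}O(\xi')$ carries the Kirillov–Kostant bracket $\{f, h\}_{K.K}(\lambda) = -\langle \lambda, [df_\lambda, dh_\lambda]\rangle$, the differentials being regarded as elements of $T_{\xi'}O(\xi')$. The Hamiltonian vector fields are $X_H(F) = \{F, H\}$ on $A^*\mathcal{G}$ and $X_h(f) = \{f, h\}_{K.K}$ on $T^*_{\xi'}O(\xi')$. A smooth function is called a first integral of such a vector field if the vector field maps it to the zero function. Let $h, f \in C^\infty(T^*_{\xi'}O(\xi'))$, and let $H, F \in C^\infty(M \times T^*_{\xi'}O(\xi'))$ be given by $H(p, \lambda) = h(\lambda)$ and $F(p, \lambda) = f(\lambda)$ (written $F = (p, f)$). Then $F$ is a first integral of $X_H$ if and only if $f$ is a first integral of $X_h$.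 -/

import Mathlib

set_option linter.unusedSectionVars false
open scoped Manifold ContDiff Topology

noncomputable section
open Filter

section LieGroupCoadjoint

variable (E : Type*) [NormedAddCommGroup E] [NormedSpace ℝ E]
  (G : Type*) [TopologicalSpace G] [ChartedSpace E G] [Group G]

/-- The Lie algebra `𝔤 = T_1 G` of `G`, with the bracket of left-invariant vector fields and
the norm of the model space `E`. -/
def LieAlg : Type _ := GroupLieAlgebra 𝓘(ℝ, E) G

namespace LieAlg

instance : NormedAddCommGroup (LieAlg E G) := inferInstanceAs (NormedAddCommGroup E)
instance : NormedSpace ℝ (LieAlg E G) := inferInstanceAs (NormedSpace ℝ E)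
instance [FiniteDimensional ℝ E] : FiniteDimensional ℝ (LieAlg E G) :=
  inferInstanceAs (FiniteDimensional ℝ E)

theorem lieGroup_minSmoothness [LieGroup 𝓘(ℝ, E) ∞ G] :
    LieGroup 𝓘(ℝ, E) (minSmoothness ℝ 3) G := by
  rw [minSmoothness_of_isRCLikeNormedField]; infer_instance

variable [FiniteDimensional ℝ E] [LieGroup 𝓘(ℝ, E) ∞ G]

instance : LieRing (LieAlg E G) :=
  haveI : CompleteSpace E := FiniteDimensional.complete ℝ E
  haveI := lieGroup_minSmoothness E G
  let L : LieRing (GroupLieAlgebra 𝓘(ℝ, E) G) := inferInstance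
  { (inferInstance : AddCommGroup (LieAlg E G)) with
    bracket := L.bracket
    add_lie := L.add_lie
    lie_add := L.lie_add
    lie_self := L.lie_self
    leibniz_lie := L.leibniz_lie }

instance : LieAlgebra ℝ (LieAlg E G) :=
  haveI : CompleteSpace E := FiniteDimensional.complete ℝ E
  haveI := lieGroup_minSmoothness E G
  let L : LieAlgebra ℝ (GroupLieAlgebra 𝓘(ℝ, E) G) := inferInstance
  { (inferInstance : Module ℝ (LieAlg E G)) with
    lie_smul := L.lie_smul }

end LieAlg

variable {G}
/-- The adjoint action: `Ad g` is the differential at `1` of `x ↦ g x g⁻¹`. -/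
def Ad (g : G) : LieAlg E G →L[ℝ] LieAlg E G :=
  (mfderiv 𝓘(ℝ, E) 𝓘(ℝ, E) (fun x : G => g * x * g⁻¹) 1 :)

end LieGroupCoadjoint


theorem fderiv_conj_local {E : Type*} [NormedAddCommGroup E] [NormedSpace ℝ E]
    {μ κ : E × E → E} {e : E} (hμ : ContDiffAt ℝ 2 μ (e, e)) (hκ : ContDiffAt ℝ 2 κ (e, e))
    (hμ1 : ∀ᶠ x in 𝓝 e, μ (x, e) = x)
    (hκe : ∀ᶠ x in 𝓝 e, κ (x, e) = e) (hκ1 : ∀ᶠ y in 𝓝 e, κ (e, y) = y)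
    (hrel : ∀ᶠ p in 𝓝 (e, e), μ (κ p, p.1) = μ p) (v w : E) :
    fderiv ℝ (fun x => fderiv ℝ κ (x, e) (0, w)) e v =
      fderiv ℝ (fderiv ℝ μ) (e, e) (v, 0) (0, w) - fderiv ℝ (fderiv ℝ μ) (e, e) (w, 0) (0, v) := by
  have hμd : DifferentiableAt ℝ (fderiv ℝ μ) (e, e) :=
    (hμ.fderiv_right (m := 1) (by norm_num)).differentiableAt (by norm_num)
  have hκd : DifferentiableAt ℝ (fderiv ℝ κ) (e, e) :=
    (hκ.fderiv_right (m := 1) (by norm_num)).differentiableAt (by norm_num)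
  have hμe : ∀ᶠ p in 𝓝 (e, e), DifferentiableAt ℝ μ p :=
    (hμ.eventually (by simp)).mono fun p hp => hp.differentiableAt (by norm_num)
  have hκev : ∀ᶠ p in 𝓝 (e, e), DifferentiableAt ℝ κ p :=
    (hκ.eventually (by simp)).mono fun p hp => hp.differentiableAt (by norm_num)
  have hc1 : Tendsto (fun x : E => (x, e)) (𝓝 e) (𝓝 (e, e)) :=
    (by fun_prop : Continuous fun x : E => (x, e)).tendsto e
  have hc2 : Tendsto (fun x : E => (e, x)) (𝓝 e) (𝓝 (e, e)) :=
    (by fun_prop : Continuous fun x : E => (e, x)).tendsto e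
  set a : E → E := fun x => fderiv ℝ κ (x, e) (0, w) with ha
  have hd1 : HasFDerivAt (fun x : E => (x, e)) (ContinuousLinearMap.inl ℝ E E) e :=
    (hasFDerivAt_id e).prodMk (hasFDerivAt_const e e)
  have hd2 : HasFDerivAt (fun x : E => (e, x)) (ContinuousLinearMap.inr ℝ E E) e :=
    (hasFDerivAt_const e e).prodMk (hasFDerivAt_id e)
  have hκee : κ (e, e) = e := hκe.self_of_nhds
  have key : (fun x => fderiv ℝ μ (e, x) (a x, 0)) =ᶠ[𝓝 e] fun x => fderiv ℝ μ (x, e) (0, w) := by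
    filter_upwards [hc1.eventually hrel.eventually_nhds, hc1.eventually hκev,
      hc1.eventually hμe, hc2.eventually hμe, hκe] with x h1 h2 h3 h4 h5
    have h6 : HasFDerivAt (fun p : E × E => (κ p, p.1))
        ((fderiv ℝ κ (x, e)).prod (ContinuousLinearMap.fst ℝ E E)) (x, e) :=
      h2.hasFDerivAt.prodMk hasFDerivAt_fst
    have h7 : HasFDerivAt μ (fderiv ℝ μ (e, x)) ((fun p : E × E => (κ p, p.1)) (x, e)) := by
      simpa [h5] using h4.hasFDerivAt
    have h8 := (h7.comp (x, e) h6).congr_of_eventuallyEq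
      (h1.mono fun p hp => hp.symm : μ =ᶠ[𝓝 (x, e)] _)
    have h9 := h8.fderiv
    simp [h9, ha]
  have hae : a e = w := by
    have h1 : HasFDerivAt (fun y : E => κ (e, y)) ((fderiv ℝ κ (e, e)).comp
        (ContinuousLinearMap.inr ℝ E E)) e :=
      HasFDerivAt.comp e (g := κ) hκev.self_of_nhds.hasFDerivAt hd2
    have h2 := (hasFDerivAt_id (𝕜 := ℝ) e).congr_of_eventuallyEq hκ1
    have h3 := congrArg (fun L => L w) (h1.unique h2)
    simpa [ha] using h3
  have hμid : ∀ u, fderiv ℝ μ (e, e) (u, 0) = u := by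
    intro u
    have h1 : HasFDerivAt (fun y : E => μ (y, e)) ((fderiv ℝ μ (e, e)).comp
        (ContinuousLinearMap.inl ℝ E E)) e :=
      HasFDerivAt.comp e (g := μ) hμe.self_of_nhds.hasFDerivAt hd1
    have h2 := (hasFDerivAt_id (𝕜 := ℝ) e).congr_of_eventuallyEq hμ1
    have h3 := congrArg (fun L => L u) (h1.unique h2)
    simpa using h3
  have hκD : HasFDerivAt (fun x : E => fderiv ℝ κ (x, e))
      ((fderiv ℝ (fderiv ℝ κ) (e, e)).comp (ContinuousLinearMap.inl ℝ E E)) e :=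
    HasFDerivAt.comp e (g := fderiv ℝ κ) hκd.hasFDerivAt hd1
  have haD : DifferentiableAt ℝ a e := (hκD.clm_apply (hasFDerivAt_const _ _)).differentiableAt
  have hL : HasFDerivAt (fun x : E => fderiv ℝ μ (e, x))
      ((fderiv ℝ (fderiv ℝ μ) (e, e)).comp (ContinuousLinearMap.inr ℝ E E)) e :=
    HasFDerivAt.comp e (g := fderiv ℝ μ) hμd.hasFDerivAt hd2
  have hR : HasFDerivAt (fun x : E => fderiv ℝ μ (x, e))
      ((fderiv ℝ (fderiv ℝ μ) (e, e)).comp (ContinuousLinearMap.inl ℝ E E)) e :=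
    HasFDerivAt.comp e (g := fderiv ℝ μ) hμd.hasFDerivAt hd1
  have hL' := hL.clm_apply (haD.hasFDerivAt.prodMk (hasFDerivAt_const (0 : E) e))
  have hR' := hR.clm_apply (hasFDerivAt_const ((0 : E), w) e)
  have hfin := congrArg (fun L => L v) (hL'.unique (hR'.congr_of_eventuallyEq key))
  have hsym := (hμ.isSymmSndFDerivAt (by simp)).eq (0, v) (w, 0)
  simp [hμid, hae] at hfin
  rw [hsym] at hfin
  rw [← hfin]; abel

section Chart
variable {E : Type*} [NormedAddCommGroup E] [NormedSpace ℝ E] [FiniteDimensional ℝ E]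
  {G : Type*} [TopologicalSpace G] [ChartedSpace E G] [Group G] [LieGroup 𝓘(ℝ, E) ∞ G]

local notation "φ" => extChartAt 𝓘(ℝ, E) (1 : G)

variable (E G) in
/-- The multiplication of `G` in the chart at `1`. -/
def chartMul (p : E × E) : E := φ ((φ).symm p.1 * (φ).symm p.2)
variable (E) in
def chartConj (g : G) (y : E) : E := φ (g * (φ).symm y * g⁻¹)
variable (E G) in
def chartConj₂ (p : E × E) : E := chartConj E ((φ).symm p.1) p.2

theorem symm_mem_nhds : ContMDiffAt 𝓘(ℝ, E) 𝓘(ℝ, E) ∞ (φ).symm (φ 1) :=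
  (contMDiffOn_extChartAt_symm (1 : G)).contMDiffAt
    (extChartAt_target_mem_nhds (I := 𝓘(ℝ, E)) (1 : G))

theorem symm_chart_one : (φ).symm (φ 1) = 1 := extChartAt_to_inv (I := 𝓘(ℝ, E)) (1 : G)

theorem contDiffAt_chartMul : ContDiffAt ℝ ∞ (chartMul E G) (φ 1, φ 1) := by
  rw [← contMDiffAt_iff_contDiffAt]
  have h1 : ContMDiffAt 𝓘(ℝ, E × E) 𝓘(ℝ, E) ∞ (fun p : E × E => (φ).symm p.1) (φ 1, φ 1) :=
    ContMDiffAt.comp _ (g := (φ).symm) symm_mem_nhds contDiff_fst.contDiffAt.contMDiffAt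
  have h2 : ContMDiffAt 𝓘(ℝ, E × E) 𝓘(ℝ, E) ∞ (fun p : E × E => (φ).symm p.2) (φ 1, φ 1) :=
    ContMDiffAt.comp _ (g := (φ).symm) symm_mem_nhds contDiff_snd.contDiffAt.contMDiffAt
  refine ContMDiffAt.comp_of_eq (g := φ) (y := 1) contMDiffAt_extChartAt (h1.mul h2) ?_
  simp

theorem contDiffAt_chartConj₂ : ContDiffAt ℝ ∞ (chartConj₂ E G) (φ 1, φ 1) := by
  rw [← contMDiffAt_iff_contDiffAt]
  have h1 : ContMDiffAt 𝓘(ℝ, E × E) 𝓘(ℝ, E) ∞ (fun p : E × E => (φ).symm p.1) (φ 1, φ 1) :=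
    ContMDiffAt.comp _ (g := (φ).symm) symm_mem_nhds contDiff_fst.contDiffAt.contMDiffAt
  have h2 : ContMDiffAt 𝓘(ℝ, E × E) 𝓘(ℝ, E) ∞ (fun p : E × E => (φ).symm p.2) (φ 1, φ 1) :=
    ContMDiffAt.comp _ (g := (φ).symm) symm_mem_nhds contDiff_snd.contDiffAt.contMDiffAt
  refine ContMDiffAt.comp_of_eq (g := φ) (y := 1) contMDiffAt_extChartAt ((h1.mul h2).mul h1.inv) ?_
  simp

theorem contDiffAt_chartConj (g : G) : ContDiffAt ℝ ∞ (chartConj E g) (φ 1) := by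
  rw [← contMDiffAt_iff_contDiffAt]
  refine ContMDiffAt.comp_of_eq (g := φ) (y := 1) contMDiffAt_extChartAt
    ((contMDiffAt_const.mul symm_mem_nhds).mul contMDiffAt_const) ?_
  simp

theorem chartConj_one (g : G) : chartConj E g (φ 1) = φ 1 := by
  simp [chartConj]

theorem Ad_eq (g : G) : (show E →L[ℝ] E from Ad E g) = fderiv ℝ (chartConj E g) (φ 1) := by
  have hd : MDifferentiableAt 𝓘(ℝ, E) 𝓘(ℝ, E) (fun x : G => g * x * g⁻¹) 1 :=
    ((contMDiffAt_const.mul contMDiffAt_id).mul contMDiffAt_const :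
      ContMDiffAt 𝓘(ℝ, E) 𝓘(ℝ, E) ∞ (fun x : G => g * x * g⁻¹) 1).mdifferentiableAt (by simp)
  have h1 : (fun x : G => g * x * g⁻¹) 1 = 1 := by simp
  have h2 : writtenInExtChartAt 𝓘(ℝ, E) 𝓘(ℝ, E) 1 (fun x : G => g * x * g⁻¹) = chartConj E g := by
    unfold writtenInExtChartAt
    rw [h1]; rfl
  have h3 : HasFDerivAt (chartConj E g) (show E →L[ℝ] E from Ad E g) (φ 1) := by
    have h3 := hd.hasMFDerivAt.2
    rw [h2, modelWithCornersSelf_coe, Set.range_id] at h3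
    have h4 : HasFDerivWithinAt (chartConj E g) (show E →L[ℝ] E from Ad E g) Set.univ (φ 1) := h3
    exact h4.hasFDerivAt Filter.univ_mem
  exact h3.fderiv.symm

theorem Ad_mul (g h : G) : Ad E (g * h) = (Ad E g).comp (Ad E h) := by
  have e1 : chartConj E (g * h) =ᶠ[𝓝 (φ (1:G))] chartConj E g ∘ chartConj E h := by
    have : IsTopologicalGroup G := topologicalGroup_of_lieGroup 𝓘(ℝ, E) ∞
    have : ContinuousAt (fun y : E => h * (φ).symm y * h⁻¹) (φ 1) :=
      (continuousAt_const.mul symm_mem_nhds.continuousAt).mul continuousAt_const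
    have h3 : ∀ᶠ y in 𝓝 (φ (1:G)), h * (φ).symm y * h⁻¹ ∈ (φ).source := by
      apply this
      have : h * (φ).symm (φ (1:G)) * h⁻¹ = 1 := by simp
      beta_reduce
      rw [this]
      exact extChartAt_source_mem_nhds (I := 𝓘(ℝ, E)) (1 : G)
    filter_upwards [h3] with y hy
    simp only [chartConj, Function.comp, (φ).left_inv hy]
    congr 1; group
  have d1 := ((contDiffAt_chartConj (E := E) g).differentiableAt (by simp)).hasFDerivAt
  have d2 := ((contDiffAt_chartConj (E := E) h).differentiableAt (by simp)).hasFDerivAt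
  rw [← chartConj_one h] at d1
  have d3 := (d1.comp _ d2).congr_of_eventuallyEq e1
  have := d3.fderiv
  rw [chartConj_one h] at this
  have a1 := Ad_eq (E := E) (g * h)
  have a2 := Ad_eq (E := E) g
  have a3 := Ad_eq (E := E) h
  rw [← a1, ← a2, ← a3] at this
  exact this

theorem Ad_one : Ad E (1 : G) = ContinuousLinearMap.id ℝ _ := by
  have := (Ad_eq (E := E) (1 : G))
  have h2 : chartConj E (1 : G) =ᶠ[𝓝 (φ (1:G))] id := by
    filter_upwards [extChartAt_target_mem_nhds (I := 𝓘(ℝ, E)) (1 : G)] with y hy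
    simpa [chartConj] using (φ).right_inv hy
  rw [h2.fderiv_eq, fderiv_id] at this
  exact this

theorem mfderiv_chart_one :
    (show E →L[ℝ] E from mfderiv 𝓘(ℝ, E) 𝓘(ℝ, E) (φ) (1 : G)) = ContinuousLinearMap.id ℝ E := by
  have h : HasMFDerivAt 𝓘(ℝ, E) 𝓘(ℝ, E) (φ) (1 : G) (ContinuousLinearMap.id ℝ E : E →L[ℝ] E) := by
    refine ⟨(contMDiffAt_extChartAt (n := ∞)).continuousAt, ?_⟩
    rw [modelWithCornersSelf_coe, Set.range_id]
    refine hasFDerivWithinAt_univ.2 ?_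
    refine (hasFDerivAt_id (𝕜 := ℝ) (φ (1:G))).congr_of_eventuallyEq ?_
    filter_upwards [extChartAt_target_mem_nhds (I := 𝓘(ℝ, E)) (1 : G)] with y hy
    exact (φ).right_inv hy
  exact h.mfderiv

theorem chartMul_right {x : E} (hx : x ∈ (φ).target) : chartMul E G (x, φ 1) = x := by
  have := (φ).right_inv hx
  simpa [chartMul] using this

theorem chartMul_left {x : E} (hx : x ∈ (φ).target) : chartMul E G (φ 1, x) = x := by
  have := (φ).right_inv hx
  simpa [chartMul] using this

theorem mulInvariant_chart (v : E) : ∀ᶠ x in 𝓝 (φ (1 : G)),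
    (mfderivWithin 𝓘(ℝ, E) 𝓘(ℝ, E) (φ).symm (Set.range 𝓘(ℝ, E)) x).inverse
      (mulInvariantVectorField (I := 𝓘(ℝ, E)) (G := G) v ((φ).symm x)) =
    fderiv ℝ (chartMul E G) (x, φ 1) (0, v) := by
  have hc1 : Tendsto (fun x : E => (x, φ (1:G))) (𝓝 (φ (1:G))) (𝓝 (φ (1:G), φ (1:G))) :=
    (by fun_prop : Continuous fun x : E => (x, φ (1:G))).tendsto _
  have hd : ∀ᶠ p in 𝓝 (φ (1:G), φ (1:G)), DifferentiableAt ℝ (chartMul E G) p :=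
    (((contDiffAt_chartMul (E := E) (G := G)).of_le (m := 1) (by simp)).eventually
      (by simp)).mono fun p hp => hp.differentiableAt (by norm_num)
  filter_upwards [hc1.eventually hd, (extChartAt_target_mem_nhds (I := 𝓘(ℝ, E)) (1 : G))]
    with x h1 hx
  have hinv := isInvertible_mfderivWithin_extChartAt_symm (I := 𝓘(ℝ, E)) (x := (1:G)) hx
  have hsd : HasMFDerivAt 𝓘(ℝ, E) 𝓘(ℝ, E) (φ).symm x
      (mfderivWithin 𝓘(ℝ, E) 𝓘(ℝ, E) (φ).symm (Set.range 𝓘(ℝ, E)) x) := by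
    have hm : MDifferentiableAt 𝓘(ℝ, E) 𝓘(ℝ, E) (φ).symm x :=
      ((contMDiffOn_extChartAt_symm (n := ∞) (1 : G)).contMDiffAt
        ((isOpen_extChartAt_target (1 : G)).mem_nhds hx)).mdifferentiableAt (by simp)
    have := hm.hasMFDerivAt
    rw [modelWithCornersSelf_coe, Set.range_id, mfderivWithin_univ]
    exact this
  set D : E →L[ℝ] E := mfderivWithin 𝓘(ℝ, E) 𝓘(ℝ, E) (φ).symm (Set.range 𝓘(ℝ, E)) x with hD
  have hgen : ∀ z, z = x → HasMFDerivAt 𝓘(ℝ, E) 𝓘(ℝ, E) (φ).symm z D := by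
    rintro z rfl; exact hsd
  set F : E → E := fun y => chartMul E G (x, y) with hF
  have hFe : F (φ (1:G)) = x := chartMul_right hx
  have hFd : HasFDerivAt F ((fderiv ℝ (chartMul E G) (x, φ 1)).comp
      (ContinuousLinearMap.inr ℝ E E)) (φ (1:G)) :=
    HasFDerivAt.comp (φ (1:G)) (g := chartMul E G) h1.hasFDerivAt
      ((hasFDerivAt_const x _).prodMk (hasFDerivAt_id _))
  have hφ : HasMFDerivAt 𝓘(ℝ, E) 𝓘(ℝ, E) (φ) (1 : G) (ContinuousLinearMap.id ℝ E : E →L[ℝ] E) := by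
    have := ((contMDiffAt_extChartAt (I := 𝓘(ℝ, E)) (n := ∞)
      (x := (1 : G))).mdifferentiableAt (by simp)).hasMFDerivAt
    have h2 := mfderiv_chart_one (E := E) (G := G)
    exact h2 ▸ this
  have hcomp := (hgen _ hFe).comp (φ (1:G)) hFd.hasMFDerivAt |>.comp (1 : G) hφ
  have heq : (fun y : G => (φ).symm x * y) =ᶠ[𝓝 1] ((φ).symm ∘ F) ∘ (φ) := by
    have : IsTopologicalGroup G := topologicalGroup_of_lieGroup 𝓘(ℝ, E) ∞
    have hcont : ContinuousAt (fun y : G => (φ).symm x * y) 1 := by fun_prop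
    have h3 : (φ).source ∈ 𝓝 ((φ).symm x * 1) := by
      rw [mul_one]
      exact (isOpen_extChartAt_source (1 : G)).mem_nhds ((φ).map_target hx)
    filter_upwards [hcont h3, extChartAt_source_mem_nhds (I := 𝓘(ℝ, E)) (1 : G)] with y hy hy2
    simp only [Function.comp, hF, chartMul]
    rw [(φ).left_inv hy2, (φ).left_inv hy]
  have hfin : mulInvariantVectorField (I := 𝓘(ℝ, E)) (G := G) v ((φ).symm x) =
      D (fderiv ℝ (chartMul E G) (x, φ 1) (0, v)) := by
    have h5 := (hcomp.congr_of_eventuallyEq heq).mfderiv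
    unfold mulInvariantVectorField
    have h6 := congrArg (fun L : E →L[ℝ] E => L v) h5
    exact h6.trans rfl
  exact (congrArg D.inverse hfin).trans (hinv.inverse_apply_eq.2 rfl)

def toAlg (v : E) : LieAlg E G := v
def ofAlg (v : LieAlg E G) : E := v

theorem lie_chart (v w : E) :
    ofAlg ⁅toAlg (G := G) v, toAlg (G := G) w⁆ =
    fderiv ℝ (fderiv ℝ (chartMul E G)) (φ (1:G), φ (1:G)) (v, 0) (0, w) -
    fderiv ℝ (fderiv ℝ (chartMul E G)) (φ (1:G), φ (1:G)) (w, 0) (0, v) := by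
  have hc1 : Tendsto (fun x : E => (x, φ (1:G))) (𝓝 (φ (1:G))) (𝓝 (φ (1:G), φ (1:G))) :=
    (by fun_prop : Continuous fun x : E => (x, φ (1:G))).tendsto _
  have hμd : DifferentiableAt ℝ (fderiv ℝ (chartMul E G)) (φ (1:G), φ (1:G)) :=
    (((contDiffAt_chartMul (E := E) (G := G)).of_le (m := 2) (ENat.LEInfty.out)).fderiv_right
      (m := 1) (by norm_num)).differentiableAt (by norm_num)
  have hR0 : HasFDerivAt (fun x : E => fderiv ℝ (chartMul E G) (x, φ 1))
      ((fderiv ℝ (fderiv ℝ (chartMul E G)) (φ 1, φ 1)).comp (ContinuousLinearMap.inl ℝ E E))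
      (φ (1:G)) :=
    HasFDerivAt.comp (φ (1:G)) (g := fderiv ℝ (chartMul E G)) hμd.hasFDerivAt
      ((hasFDerivAt_id _).prodMk (hasFDerivAt_const _ _))
  have hR : ∀ u : E, HasFDerivAt (fun x : E => fderiv ℝ (chartMul E G) (x, φ 1) (0, u)) _
      (φ (1:G)) := fun u =>
    hR0.clm_apply (hasFDerivAt_const (0, u) _)
  have hV : ∀ u : E, ((fun x : E => (mfderivWithin 𝓘(ℝ, E) 𝓘(ℝ, E) (φ).symm
      (Set.range 𝓘(ℝ, E)) x).inverse (mulInvariantVectorField (I := 𝓘(ℝ, E)) (G := G) u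
        ((φ).symm x)) : E → E)) =ᶠ[𝓝 (φ (1:G))]
      fun x => fderiv ℝ (chartMul E G) (x, φ 1) (0, u) := fun u => mulInvariant_chart u
  have h0 : ∀ u : E, fderiv ℝ (chartMul E G) (φ (1:G), φ 1) (0, u) = u := by
    intro u
    have h1 : HasFDerivAt (fun y : E => chartMul E G (φ 1, y)) ((fderiv ℝ (chartMul E G)
        (φ 1, φ 1)).comp (ContinuousLinearMap.inr ℝ E E)) (φ (1:G)) :=
      HasFDerivAt.comp (φ (1:G)) (g := chartMul E G)
        ((contDiffAt_chartMul (E := E) (G := G)).differentiableAt (by simp)).hasFDerivAt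
        ((hasFDerivAt_const _ _).prodMk (hasFDerivAt_id _))
    have h2 := (hasFDerivAt_id (𝕜 := ℝ) (φ (1:G))).congr_of_eventuallyEq
      (f₁ := fun y : E => chartMul E G (φ 1, y))
      (by filter_upwards [extChartAt_target_mem_nhds (I := 𝓘(ℝ, E)) (1 : G)] with y hy
          exact chartMul_left hy)
    simpa using congrArg (fun L => L u) (h1.unique h2)
  have hb : ∃ (L : E →L[ℝ] E) (Z : E → E → E) (S : Set E),
      L = (show E →L[ℝ] E from mfderiv 𝓘(ℝ, E) 𝓘(ℝ, E) (φ) (1 : G)) ∧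
      (∀ u : E, Z u = fun x : E => (show E from (mfderivWithin 𝓘(ℝ, E) 𝓘(ℝ, E) (φ).symm
          (Set.range 𝓘(ℝ, E)) x).inverse (mulInvariantVectorField (I := 𝓘(ℝ, E)) (G := G) u
            ((φ).symm x)))) ∧
      S = (φ).symm ⁻¹' Set.univ ∩ Set.range 𝓘(ℝ, E) ∧
      ofAlg ⁅toAlg (G := G) v, toAlg (G := G) w⁆ =
        L.inverse (VectorField.lieBracketWithin ℝ (Z v) (Z w) S (φ (1:G))) :=
    ⟨_, _, _, rfl, fun _ => rfl, rfl, rfl⟩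
  obtain ⟨L, Z, S, hL, hZ, hS, hb⟩ := hb
  have hL1 : L = ContinuousLinearMap.id ℝ E := hL.trans mfderiv_chart_one
  have hS1 : S = Set.univ := by
    rw [hS, modelWithCornersSelf_coe, Set.range_id, Set.preimage_univ, Set.inter_univ]
  have hZ1 : ∀ u, Z u =ᶠ[𝓝 (φ (1:G))] fun x => fderiv ℝ (chartMul E G) (x, φ 1) (0, u) :=
    fun u => (hZ u) ▸ hV u
  refine hb.trans ?_
  rw [hL1, ContinuousLinearMap.inverse_id, hS1, VectorField.lieBracketWithin_univ,
    (hZ1 v).lieBracket_vectorField_eq (hZ1 w)]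
  simp only [VectorField.lieBracket]
  rw [(hR v).fderiv, (hR w).fderiv]
  simp only [add_apply, ContinuousLinearMap.flip_apply,
    ContinuousLinearMap.comp_apply, ContinuousLinearMap.inl_apply,
    ContinuousLinearMap.id_apply, zero_apply, map_zero, zero_add, h0]

variable (E) in
def chartAd (g : G) : E →L[ℝ] E := Ad E g

theorem chartAd_eventually : (fun x : E => chartAd E ((φ).symm x)) =ᶠ[𝓝 (φ (1:G))]
    fun x => (fderiv ℝ (chartConj₂ E G) (x, φ 1)).comp (ContinuousLinearMap.inr ℝ E E) := by
  have hc1 : Tendsto (fun x : E => (x, φ (1:G))) (𝓝 (φ (1:G))) (𝓝 (φ (1:G), φ (1:G))) :=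
    (by fun_prop : Continuous fun x : E => (x, φ (1:G))).tendsto _
  have hd : ∀ᶠ p in 𝓝 (φ (1:G), φ (1:G)), DifferentiableAt ℝ (chartConj₂ E G) p :=
    (((contDiffAt_chartConj₂ (E := E) (G := G)).of_le (m := 1) (by simp)).eventually
      (by simp)).mono fun p hp => hp.differentiableAt (by norm_num)
  filter_upwards [hc1.eventually hd] with x hx
  have h1 : HasFDerivAt (fun y : E => chartConj₂ E G (x, y)) ((fderiv ℝ (chartConj₂ E G)
        (x, φ 1)).comp (ContinuousLinearMap.inr ℝ E E)) (φ (1:G)) :=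
    HasFDerivAt.comp (φ (1:G)) (g := chartConj₂ E G) hx.hasFDerivAt
        ((hasFDerivAt_const _ _).prodMk (hasFDerivAt_id _))
  exact (Ad_eq _).trans h1.fderiv

theorem contDiffAt_chartAd : ContDiffAt ℝ 1 (fun x : E => chartAd E ((φ).symm x)) (φ (1:G)) := by
  refine ContDiffAt.congr_of_eventuallyEq ?_ chartAd_eventually
  have h1 : ContDiffAt ℝ 1 (fderiv ℝ (chartConj₂ E G)) (φ (1:G), φ (1:G)) :=
    ((contDiffAt_chartConj₂ (E := E) (G := G)).of_le (m := 2) (ENat.LEInfty.out)).fderiv_right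
      (m := 1) (by norm_num)
  have h2 : ContDiffAt ℝ 1 (fun x : E => fderiv ℝ (chartConj₂ E G) (x, φ 1)) (φ (1:G)) :=
    ContDiffAt.comp (φ (1:G)) (g := fderiv ℝ (chartConj₂ E G)) h1
      (contDiff_id.prodMk contDiff_const).contDiffAt
  exact h2.clm_comp contDiffAt_const

theorem fderiv_chartAd (v w : E) :
    fderiv ℝ (fun x : E => chartAd E ((φ).symm x)) (φ (1:G)) v w =
      ofAlg ⁅toAlg (G := G) v, toAlg (G := G) w⁆ := by
  refine Eq.trans ?_ (lie_chart v w).symm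
  have htar := extChartAt_target_mem_nhds (I := 𝓘(ℝ, E)) (1 : G)
  have hAd := (contDiffAt_chartAd (E := E) (G := G)).differentiableAt (by norm_num)
  have h1 : fderiv ℝ (fun x : E => chartAd E ((φ).symm x)) (φ (1:G)) v w =
      fderiv ℝ (fun x : E => fderiv ℝ (chartConj₂ E G) (x, φ 1) (0, w)) (φ (1:G)) v := by
    have h2 : (fun x : E => chartAd E ((φ).symm x) w) =ᶠ[𝓝 (φ (1:G))]
        fun x : E => fderiv ℝ (chartConj₂ E G) (x, φ 1) (0, w) := by
      filter_upwards [chartAd_eventually (E := E) (G := G)] with x hx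
      rw [hx]; rfl
    rw [← h2.fderiv_eq, (hAd.hasFDerivAt.clm_apply (hasFDerivAt_const w _)).fderiv]
    simp
  rw [h1]
  refine fderiv_conj_local ((contDiffAt_chartMul (E := E) (G := G)).of_le ENat.LEInfty.out)
    ((contDiffAt_chartConj₂ (E := E) (G := G)).of_le ENat.LEInfty.out) ?_ ?_ ?_ ?_ _ _
  · filter_upwards [htar] with x hx using chartMul_right hx
  · filter_upwards with x using chartConj_one _
  · filter_upwards [htar] with x hx
    have := (φ).right_inv hx
    simpa [chartConj₂, chartConj] using this
  · have : IsTopologicalGroup G := topologicalGroup_of_lieGroup 𝓘(ℝ, E) ∞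
    have hs1 : ContinuousAt (fun p : E × E => (φ).symm p.1) (φ (1:G), φ (1:G)) :=
      ContinuousAt.comp (g := (φ).symm) symm_mem_nhds.continuousAt continuousAt_fst
    have hs2 : ContinuousAt (fun p : E × E => (φ).symm p.2) (φ (1:G), φ (1:G)) :=
      ContinuousAt.comp (g := (φ).symm) symm_mem_nhds.continuousAt continuousAt_snd
    have hcont : ContinuousAt (fun p : E × E => (φ).symm p.1 * (φ).symm p.2 * ((φ).symm p.1)⁻¹)
        (φ (1:G), φ (1:G)) := (hs1.mul hs2).mul hs1.inv
    have h3 : ∀ᶠ p : E × E in 𝓝 (φ (1:G), φ (1:G)),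
        (φ).symm p.1 * (φ).symm p.2 * ((φ).symm p.1)⁻¹ ∈ (φ).source := by
      apply hcont
      have : (φ).symm (φ (1:G)) * (φ).symm (φ (1:G)) * ((φ).symm (φ (1:G)))⁻¹ = 1 := by simp
      beta_reduce
      rw [this]
      exact extChartAt_source_mem_nhds (I := 𝓘(ℝ, E)) (1 : G)
    filter_upwards [h3] with p hp
    simp only [chartMul, chartConj₂, chartConj]
    rw [(φ).left_inv hp]
    congr 1; group

theorem chartAd_mul (g h : G) : chartAd E (g * h) = (chartAd E g).comp (chartAd E h) :=
  Ad_mul g h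

theorem chartAd_one : chartAd E (1 : G) = ContinuousLinearMap.id ℝ E := Ad_one

theorem chartAd_chartMul : ∀ᶠ p : E × E in 𝓝 (φ (1:G), φ (1:G)),
    chartAd E ((φ).symm (chartMul E G p)) =
      (chartAd E ((φ).symm p.1)).comp (chartAd E ((φ).symm p.2)) := by
  have : IsTopologicalGroup G := topologicalGroup_of_lieGroup 𝓘(ℝ, E) ∞
  have hs1 : ContinuousAt (fun p : E × E => (φ).symm p.1) (φ (1:G), φ (1:G)) :=
    ContinuousAt.comp (g := (φ).symm) symm_mem_nhds.continuousAt continuousAt_fst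
  have hs2 : ContinuousAt (fun p : E × E => (φ).symm p.2) (φ (1:G), φ (1:G)) :=
    ContinuousAt.comp (g := (φ).symm) symm_mem_nhds.continuousAt continuousAt_snd
  have h3 : ∀ᶠ p : E × E in 𝓝 (φ (1:G), φ (1:G)),
      (φ).symm p.1 * (φ).symm p.2 ∈ (φ).source := by
    have hcont : ContinuousAt (fun p : E × E => (φ).symm p.1 * (φ).symm p.2)
      (φ (1:G), φ (1:G)) := hs1.mul hs2
    apply hcont
    have : (φ).symm (φ (1:G)) * (φ).symm (φ (1:G)) = 1 := by simp
    beta_reduce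
    rw [this]
    exact extChartAt_source_mem_nhds (I := 𝓘(ℝ, E)) (1 : G)
  filter_upwards [h3] with p hp
  rw [chartMul, (φ).left_inv hp, chartAd_mul]

/-- derivative of `Ad` along right-invariant directions -/
theorem fderiv_chartAd_right (v : E) : ∀ᶠ x : E in 𝓝 (φ (1:G)), ∀ w : E,
    fderiv ℝ (fun x : E => chartAd E ((φ).symm x)) x
      (fderiv ℝ (chartMul E G) (φ 1, x) (v, 0)) w =
    fderiv ℝ (fun x : E => chartAd E ((φ).symm x)) (φ (1:G)) v (chartAd E ((φ).symm x) w) := by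
  have hc2 : Tendsto (fun x : E => (φ (1:G), x)) (𝓝 (φ (1:G))) (𝓝 (φ (1:G), φ (1:G))) :=
    (by fun_prop : Continuous fun x : E => (φ (1:G), x)).tendsto _
  have hd : ∀ᶠ p in 𝓝 (φ (1:G), φ (1:G)), DifferentiableAt ℝ (chartMul E G) p :=
    (((contDiffAt_chartMul (E := E) (G := G)).of_le (m := 1) (by simp)).eventually
      (by simp)).mono fun p hp => hp.differentiableAt (by norm_num)
  have hA : ∀ᶠ x in 𝓝 (φ (1:G)),
      DifferentiableAt ℝ (fun x : E => chartAd E ((φ).symm x)) x :=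
    ((contDiffAt_chartAd (E := E) (G := G)).eventually
      (by simp)).mono fun p hp => hp.differentiableAt (by norm_num)
  filter_upwards [hc2.eventually hd, hA, hc2.eventually chartAd_chartMul.eventually_nhds,
    extChartAt_target_mem_nhds (I := 𝓘(ℝ, E)) (1 : G)] with x h1 h2 h3 h4 w
  have hcx : Tendsto (fun y : E => (y, x)) (𝓝 (φ (1:G))) (𝓝 (φ (1:G), x)) :=
    (by fun_prop : Continuous fun y : E => (y, x)).tendsto _
  have e1 := hcx.eventually h3
  have d1 : HasFDerivAt (fun y : E => chartMul E G (y, x)) ((fderiv ℝ (chartMul E G)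
      (φ 1, x)).comp (ContinuousLinearMap.inl ℝ E E)) (φ (1:G)) :=
    HasFDerivAt.comp (φ (1:G)) (g := chartMul E G) h1.hasFDerivAt
      ((hasFDerivAt_id _).prodMk (hasFDerivAt_const _ _))
  have hx : chartMul E G (φ (1:G), x) = x := chartMul_left h4
  have d2 : HasFDerivAt (fun x : E => chartAd E ((φ).symm x))
      (fderiv ℝ (fun x : E => chartAd E ((φ).symm x)) x)
      ((fun y : E => chartMul E G (y, x)) (φ (1:G))) := by
    beta_reduce; rw [hx]; exact h2.hasFDerivAt
  have d3 := (d2.comp (φ (1:G)) d1).clm_apply (hasFDerivAt_const w _)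
  have d4 := (hA.self_of_nhds.hasFDerivAt.clm_apply
    (hasFDerivAt_const (chartAd E ((φ).symm x) w) (φ (1:G))))
  have e2 : (fun y : E => chartAd E ((φ).symm y) (chartAd E ((φ).symm x) w)) =ᶠ[𝓝 (φ (1:G))]
      fun y : E => ((fun x : E => chartAd E ((φ).symm x)) ∘ fun y => chartMul E G (y, x)) y w := by
    filter_upwards [e1] with y hy
    simp only [Function.comp]
    rw [hy]; rfl
  have := congrArg (fun L => L v) (d3.unique (d4.congr_of_eventuallyEq e2.symm))
  simpa using this

theorem ideal_local (η : E →L[ℝ] ℝ)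
    (hN : ∀ (c g : G), (η.comp (chartAd E c) = η) → η.comp (chartAd E (g * c * g⁻¹)) = η)
    (v : E) (hv : ∀ y, η (fderiv ℝ (fun x : E => chartAd E ((φ).symm x)) (φ (1:G)) v y) = 0)
    (w z : E) : η (fderiv ℝ (fun x : E => chartAd E ((φ).symm x)) (φ (1:G)) w
      (fderiv ℝ (fun x : E => chartAd E ((φ).symm x)) (φ (1:G)) v z)) = 0 := by
  set A : E → E →L[ℝ] E := fun x : E => chartAd E ((φ).symm x) with hA
  have hAe : A (φ (1:G)) = ContinuousLinearMap.id ℝ E := by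
    simp only [hA]; rw [symm_chart_one, chartAd_one]
  have hAd : ∀ᶠ x in 𝓝 (φ (1:G)), DifferentiableAt ℝ A x :=
    ((contDiffAt_chartAd (E := E) (G := G)).eventually
      (by simp)).mono fun p hp => hp.differentiableAt (by norm_num)
  have hf : ContDiffAt ℝ 1 (fun x : E => fderiv ℝ (chartMul E G) (φ 1, x) (v, 0)) (φ (1:G)) := by
    have h1 : ContDiffAt ℝ 1 (fderiv ℝ (chartMul E G)) (φ (1:G), φ (1:G)) :=
      ((contDiffAt_chartMul (E := E) (G := G)).of_le (m := 2) (ENat.LEInfty.out)).fderiv_right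
        (m := 1) (by norm_num)
    have h2 : ContDiffAt ℝ 1 (fun x : E => fderiv ℝ (chartMul E G) (φ 1, x)) (φ (1:G)) :=
      ContDiffAt.comp (φ (1:G)) (g := fderiv ℝ (chartMul E G)) h1
        (contDiff_const.prodMk contDiff_id).contDiffAt
    exact h2.clm_apply contDiffAt_const
  have hfe : fderiv ℝ (chartMul E G) (φ (1:G), φ 1) (v, 0) = v := by
    have h1 : HasFDerivAt (fun y : E => chartMul E G (y, φ 1)) ((fderiv ℝ (chartMul E G)
        (φ 1, φ 1)).comp (ContinuousLinearMap.inl ℝ E E)) (φ (1:G)) :=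
      HasFDerivAt.comp (φ (1:G)) (g := chartMul E G)
        ((contDiffAt_chartMul (E := E) (G := G)).differentiableAt (by simp)).hasFDerivAt
        ((hasFDerivAt_id _).prodMk (hasFDerivAt_const _ _))
    have h2 := (hasFDerivAt_id (𝕜 := ℝ) (φ (1:G))).congr_of_eventuallyEq
      (f₁ := fun y : E => chartMul E G (y, φ 1))
      (by filter_upwards [extChartAt_target_mem_nhds (I := 𝓘(ℝ, E)) (1 : G)] with y hy
          exact chartMul_right hy)
    simpa using congrArg (fun L => L v) (h1.unique h2)
  have : CompleteSpace E := FiniteDimensional.complete ℝ E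
  obtain ⟨α, hα0, ε, hε, hα⟩ :=
    hf.exists_forall_mem_closedBall_exists_eq_forall_mem_Ioo_hasDerivAt₀ 0
  have hαd0 : HasDerivAt α v 0 := by
    have := hα 0 (by constructor <;> linarith)
    rwa [hα0, hfe] at this
  have hαc : Tendsto α (𝓝 0) (𝓝 (φ (1:G))) := by
    have := hαd0.continuousAt.tendsto
    rwa [hα0] at this
  have hev : ∀ᶠ t in 𝓝 (0:ℝ), DifferentiableAt ℝ A (α t) ∧
      (∀ y : E, fderiv ℝ A (α t) (fderiv ℝ (chartMul E G) (φ 1, α t) (v, 0)) y =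
        fderiv ℝ A (φ (1:G)) v (A (α t) y)) ∧ t ∈ Set.Ioo (0 - ε) (0 + ε) :=
    (hαc.eventually hAd).and ((hαc.eventually (fderiv_chartAd_right v)).and
      (Ioo_mem_nhds (by linarith) (by linarith)))
  obtain ⟨δ, hδ, hball⟩ := Metric.eventually_nhds_iff_ball.1 hev
  have hder : ∀ t ∈ Metric.ball (0:ℝ) δ, ∀ y : E, HasDerivAt (fun t => η (A (α t) y)) 0 t := by
    intro t ht y
    obtain ⟨h1, h2, h3⟩ := hball t ht
    have h4 := (h1.hasFDerivAt.comp_hasDerivAt t (hα t h3)).clm_apply (hasDerivAt_const t y)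
    have h5 := η.hasFDerivAt.comp_hasDerivAt t h4
    have h6 := h2 y
    refine h5.congr_deriv ?_
    rw [h6, map_zero, add_zero, hv]
  have hstab : ∀ t ∈ Metric.ball (0:ℝ) δ, η.comp (A (α t)) = η := by
    intro t ht
    ext y
    have h0 : (0:ℝ) ∈ Metric.ball (0:ℝ) δ := Metric.mem_ball_self hδ
    have h1 := (convex_ball (0:ℝ) δ).is_const_of_fderivWithin_eq_zero (𝕜 := ℝ)
      (f := fun t => η (A (α t) y))
      (fun s hs => (hder s hs y).differentiableAt.differentiableWithinAt)
      (fun s hs => by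
        rw [fderivWithin_of_isOpen Metric.isOpen_ball hs]
        ext
        simp [(hder s hs y).deriv]) ht h0
    rw [hα0, hAe] at h1
    exact h1
  have hconj : ∀ (g : G) (y : E), η (chartAd E g (fderiv ℝ A (φ (1:G)) v y)) = 0 := by
    intro g y
    have h1 : (fun t => η (chartAd E g (A (α t) y))) =ᶠ[𝓝 0] fun _ => η (chartAd E g y) := by
      filter_upwards [Metric.ball_mem_nhds (0:ℝ) hδ] with t ht
      have h2 := hN _ g (hstab t ht)
      have h3 := congrArg (fun L => L (chartAd E g y)) h2
      rw [chartAd_mul, chartAd_mul] at h3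
      have h4 : chartAd E g⁻¹ (chartAd E g y) = y := by
        have := congrArg (fun L => L y) (chartAd_mul (E := E) g⁻¹ g)
        rw [inv_mul_cancel, chartAd_one] at this
        exact this.symm
      simp only [ContinuousLinearMap.comp_apply, h4] at h3
      exact h3
    have h2 : HasDerivAt (fun t => η (chartAd E g (A (α t) y)))
        (η (chartAd E g (fderiv ℝ A (φ (1:G)) v y))) 0 := by
      have h3 : HasFDerivAt A (fderiv ℝ A (φ (1:G))) (α 0) := by
        rw [hα0]; exact hAd.self_of_nhds.hasFDerivAt
      have h4 := (h3.comp_hasDerivAt 0 hαd0).clm_apply (hasDerivAt_const (0:ℝ) y)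
      have h5 := (η.comp (chartAd E g)).hasFDerivAt.comp_hasDerivAt 0 h4
      refine h5.congr_deriv ?_
      rw [map_zero, add_zero]
      rfl
    exact h2.unique ((hasDerivAt_const (0:ℝ) _).congr_of_eventuallyEq h1)
  have h1 := (hAd.self_of_nhds.hasFDerivAt.clm_apply
    (hasFDerivAt_const (fderiv ℝ A (φ (1:G)) v z) (φ (1:G))))
  have h2 := η.hasFDerivAt.comp (φ (1:G)) h1
  have h3 : (η ∘ fun x => A x (fderiv ℝ A (φ (1:G)) v z)) = fun _ => 0 := by
    funext x; exact hconj _ _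
  rw [h3] at h2
  have h4 := congrArg (fun L => L w) (h2.unique (hasFDerivAt_const (0:ℝ) (φ (1:G))))
  simpa using h4

end Chart

section CoadjointOrbit
variable {E : Type*} [NormedAddCommGroup E] [NormedSpace ℝ E]
  {G : Type*} [TopologicalSpace G] [ChartedSpace E G] [Group G]

/-- The co-adjoint action `⟨Ad*_g ξ, X⟩ = ⟨ξ, Ad_{g⁻¹} X⟩`. -/
def coAd (g : G) (ξ : StrongDual ℝ (LieAlg E G)) : StrongDual ℝ (LieAlg E G) :=
  ξ.comp (Ad E g⁻¹)

/-- The co-adjoint orbit `O(ξ) = {Ad*_g ξ | g ∈ G}`. -/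
def coadOrbit (ξ : StrongDual ℝ (LieAlg E G)) : Set (StrongDual ℝ (LieAlg E G)) :=
  Set.range fun g : G => coAd g ξ

variable [FiniteDimensional ℝ E] [LieGroup 𝓘(ℝ, E) ∞ G]

theorem coAd_one (ξ : StrongDual ℝ (LieAlg E G)) : coAd 1 ξ = ξ := by
  rw [coAd, inv_one, Ad_one, ContinuousLinearMap.comp_id]

theorem coAd_mul (g h : G) (ξ : StrongDual ℝ (LieAlg E G)) :
    coAd (g * h) ξ = coAd g (coAd h ξ) := by
  rw [coAd, mul_inv_rev, Ad_mul, coAd, coAd, ContinuousLinearMap.comp_assoc]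

theorem coAd_inv_eq {g : G} {ξ : StrongDual ℝ (LieAlg E G)} (h : coAd g ξ = ξ) :
    coAd g⁻¹ ξ = ξ := by
  conv_lhs => rw [← h]
  rw [← coAd_mul, inv_mul_cancel, coAd_one]

/-- The stabilizer `{g | Ad*_g ξ = ξ}`. -/
def coadStabilizer (ξ : StrongDual ℝ (LieAlg E G)) : Subgroup G where
  carrier := {g | coAd g ξ = ξ}
  one_mem' := coAd_one ξ
  mul_mem' := fun {a b} ha hb => by
    have ha' : coAd a ξ = ξ := ha
    have hb' : coAd b ξ = ξ := hb
    show coAd (a * b) ξ = ξ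
    rw [coAd_mul, hb', ha']
  inv_mem' := fun {a} ha => coAd_inv_eq ha

/-- The infinitesimal co-adjoint action `⟨ad*_V ξ, Y⟩ = ⟨ξ, [Y, V]⟩`, as a linear map in `V`. -/
def coad (ξ : StrongDual ℝ (LieAlg E G)) : LieAlg E G →ₗ[ℝ] StrongDual ℝ (LieAlg E G) where
  toFun V := LinearMap.toContinuousLinearMap
    { toFun := fun Y => ξ ⁅Y, V⁆
      map_add' := fun Y Z => by rw [add_lie, map_add]
      map_smul' := fun c Y => by rw [smul_lie, map_smul]; rfl }
  map_add' V W := by ext Y; exact (congrArg ξ (lie_add Y V W)).trans (map_add ξ _ _)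
  map_smul' c V := by ext Y; exact (congrArg ξ (lie_smul c Y V)).trans (map_smul ξ _ _)

@[simp] theorem coad_apply (ξ : StrongDual ℝ (LieAlg E G)) (V Y : LieAlg E G) :
    coad ξ V Y = ξ ⁅Y, V⁆ := rfl

/-- The tangent space `T_ξ O(ξ) = {ad*_V ξ | V ∈ 𝔤}`, as a subspace of `𝔤*`. -/
def coadTangentSubmodule (ξ : StrongDual ℝ (LieAlg E G)) : Submodule ℝ (StrongDual ℝ (LieAlg E G)) :=
  LinearMap.range (coad ξ)

/-- The tangent space `T_ξ O(ξ)`, as a normed space. -/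
def CoadTangent (ξ : StrongDual ℝ (LieAlg E G)) : Type _ := coadTangentSubmodule ξ

instance (ξ : StrongDual ℝ (LieAlg E G)) : NormedAddCommGroup (CoadTangent ξ) :=
  inferInstanceAs (NormedAddCommGroup (coadTangentSubmodule ξ))
instance (ξ : StrongDual ℝ (LieAlg E G)) : NormedSpace ℝ (CoadTangent ξ) :=
  inferInstanceAs (NormedSpace ℝ (coadTangentSubmodule ξ))
instance (ξ : StrongDual ℝ (LieAlg E G)) : FiniteDimensional ℝ (CoadTangent ξ) :=
  inferInstanceAs (FiniteDimensional ℝ (coadTangentSubmodule ξ))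

/-- The inclusion `T_ξ O(ξ) → 𝔤*`. -/
def coadInclusion (ξ : StrongDual ℝ (LieAlg E G)) :
    CoadTangent ξ →L[ℝ] StrongDual ℝ (LieAlg E G) :=
  (coadTangentSubmodule ξ).subtypeL

/-- `ad*_V ξ` as an element of `T_ξ O(ξ)`. -/
def coadVec (ξ : StrongDual ℝ (LieAlg E G)) : LieAlg E G →ₗ[ℝ] CoadTangent ξ :=
  (coad ξ).rangeRestrict

theorem coadVec_surjective (ξ : StrongDual ℝ (LieAlg E G)) : Function.Surjective (coadVec ξ) :=
  (coad ξ).surjective_rangeRestrict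

theorem coadVec_eq_zero {ξ : StrongDual ℝ (LieAlg E G)} {V : LieAlg E G} :
    coadVec ξ V = 0 ↔ ∀ Y : LieAlg E G, ξ ⁅Y, V⁆ = 0 := by
  constructor
  · intro h Y
    exact congrArg (fun σ : CoadTangent ξ => coadInclusion ξ σ Y) h
  · intro h
    apply Subtype.ext
    ext Y
    exact h Y

theorem coadVec_lie_eq_zero (ξ : StrongDual ℝ (LieAlg E G)) [hN : (coadStabilizer ξ).Normal]
    {V : LieAlg E G} (hV : coadVec ξ V = 0) (W : LieAlg E G) : coadVec ξ ⁅V, W⁆ = 0 := by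
  rw [coadVec_eq_zero] at hV ⊢
  intro Y
  have key := ideal_local (E := E) (G := G) (show E →L[ℝ] ℝ from ξ) ?_ (ofAlg V) ?_
    (ofAlg Y) (ofAlg W)
  · rw [fderiv_chartAd, fderiv_chartAd] at key
    exact key
  · intro c g hc
    have hc' : coAd c⁻¹ ξ = ξ := by
      rw [coAd, inv_inv]; exact hc
    have h1 : c⁻¹ ∈ coadStabilizer ξ := hc'
    have h2 := hN.conj_mem _ ((coadStabilizer ξ).inv_mem h1) g
    have h3 : coAd (g * c⁻¹⁻¹ * g⁻¹)⁻¹ ξ = ξ := (coadStabilizer ξ).inv_mem h2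
    rw [coAd, inv_inv, inv_inv] at h3
    exact h3
  · intro y
    rw [fderiv_chartAd]
    have h1 := hV (toAlg y)
    rw [← lie_skew, map_neg, neg_eq_zero] at h1
    exact h1

theorem coadVec_lie_congr (ξ : StrongDual ℝ (LieAlg E G)) [(coadStabilizer ξ).Normal]
    {V V' W W' : LieAlg E G} (hV : coadVec ξ V = coadVec ξ V') (hW : coadVec ξ W = coadVec ξ W') :
    coadVec ξ ⁅V, W⁆ = coadVec ξ ⁅V', W'⁆ := by
  have h1 : coadVec ξ ⁅V - V', W⁆ = 0 := coadVec_lie_eq_zero ξ (by rw [map_sub, hV, sub_self]) W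
  have h2 : coadVec ξ ⁅W - W', V'⁆ = 0 := coadVec_lie_eq_zero ξ (by rw [map_sub, hW, sub_self]) V'
  rw [sub_lie, map_sub, sub_eq_zero] at h1 h2
  rw [h1, ← lie_skew V' W, ← lie_skew V' W', map_neg, map_neg, h2]

variable (ξ : StrongDual ℝ (LieAlg E G))

/-- The bracket `[ad*_V ξ, ad*_W ξ] = ad*_{[V, W]} ξ` on `T_ξ O(ξ)`. -/
instance : Bracket (CoadTangent ξ) (CoadTangent ξ) where
  bracket σ τ := coadVec ξ ⁅(coadVec_surjective ξ σ).choose, (coadVec_surjective ξ τ).choose⁆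

variable [(coadStabilizer ξ).Normal]

theorem coadVec_lie (V W : LieAlg E G) : ⁅coadVec ξ V, coadVec ξ W⁆ = coadVec ξ ⁅V, W⁆ :=
  coadVec_lie_congr ξ (coadVec_surjective ξ _).choose_spec (coadVec_surjective ξ _).choose_spec

/-- `T_ξ O(ξ)` is a Lie algebra as soon as the stabilizer of `ξ` is normal. -/
instance : LieRing (CoadTangent ξ) :=
  { (inferInstance : AddCommGroup (CoadTangent ξ)), (inferInstance : Bracket (CoadTangent ξ) (CoadTangent ξ)) with
    add_lie := fun σ τ υ => by
      obtain ⟨U, rfl⟩ := coadVec_surjective ξ σ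
      obtain ⟨V, rfl⟩ := coadVec_surjective ξ τ
      obtain ⟨W, rfl⟩ := coadVec_surjective ξ υ
      simp only [← map_add, coadVec_lie, add_lie]
    lie_add := fun σ τ υ => by
      obtain ⟨U, rfl⟩ := coadVec_surjective ξ σ
      obtain ⟨V, rfl⟩ := coadVec_surjective ξ τ
      obtain ⟨W, rfl⟩ := coadVec_surjective ξ υ
      simp only [← map_add, coadVec_lie, lie_add]
    lie_self := fun σ => by
      obtain ⟨U, rfl⟩ := coadVec_surjective ξ σ
      rw [coadVec_lie, lie_self, map_zero]
    leibniz_lie := fun σ τ υ => by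
      obtain ⟨U, rfl⟩ := coadVec_surjective ξ σ
      obtain ⟨V, rfl⟩ := coadVec_surjective ξ τ
      obtain ⟨W, rfl⟩ := coadVec_surjective ξ υ
      simp only [coadVec_lie]
      rw [leibniz_lie, map_add] }

instance : LieAlgebra ℝ (CoadTangent ξ) :=
  { (inferInstance : Module ℝ (CoadTangent ξ)) with
    lie_smul := fun c σ τ => by
      obtain ⟨U, rfl⟩ := coadVec_surjective ξ σ
      obtain ⟨V, rfl⟩ := coadVec_surjective ξ τ
      rw [← map_smul, coadVec_lie, coadVec_lie, lie_smul, map_smul] }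

end CoadjointOrbit

section Bidual
variable {V : Type*} [NormedAddCommGroup V] [NormedSpace ℝ V] [FiniteDimensional ℝ V]

/-- The canonical isomorphism `V ≃ V**` of a finite-dimensional space. -/
def bidualEquiv : V ≃ₗ[ℝ] StrongDual ℝ (StrongDual ℝ V) :=
  LinearEquiv.ofInjectiveOfFinrankEq
    (NormedSpace.inclusionInDoubleDual ℝ V : V →ₗ[ℝ] StrongDual ℝ (StrongDual ℝ V))
    (by
      intro x y h
      exact (NormedSpace.inclusionInDoubleDualLi ℝ).injective (a₁ := x) (a₂ := y) h)
    (by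
      have h1 : Module.finrank ℝ (StrongDual ℝ V) = Module.finrank ℝ V :=
        ((LinearMap.toContinuousLinearMap (𝕜 := ℝ) (E := V) (F' := ℝ)).finrank_eq).symm.trans
          Subspace.dual_finrank_eq
      have h2 : Module.finrank ℝ (StrongDual ℝ (StrongDual ℝ V)) =
          Module.finrank ℝ (StrongDual ℝ V) :=
        ((LinearMap.toContinuousLinearMap (𝕜 := ℝ) (E := StrongDual ℝ V) (F' := ℝ)).finrank_eq).symm.trans
          Subspace.dual_finrank_eq
      rw [h2, h1])

theorem bidualEquiv_apply (v : V) (δ : StrongDual ℝ V) : bidualEquiv v δ = δ v := rfl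
end Bidual

section Algebroid

/-- The differential of a real function, as a covector. -/
def covector (EM : Type*) [NormedAddCommGroup EM] [NormedSpace ℝ EM]
    {M : Type*} [TopologicalSpace M] [ChartedSpace EM M] (l : M → ℝ) (p : M) :
    TangentSpace 𝓘(ℝ, EM) p →L[ℝ] ℝ :=
  mfderiv 𝓘(ℝ, EM) 𝓘(ℝ) l p

variable (EM : Type*) [NormedAddCommGroup EM] [NormedSpace ℝ EM]
  (M : Type*) [TopologicalSpace M] [ChartedSpace EM M]
  (V : Type*) [NormedAddCommGroup V] [NormedSpace ℝ V]

/-- A Lie algebroid structure on the trivial vector bundle `M × V → M`; its sections are the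
smooth maps `M → V`. -/
structure LieAlgebroid [IsManifold 𝓘(ℝ, EM) ∞ M] where
  anchor : ∀ p : M, V →L[ℝ] TangentSpace 𝓘(ℝ, EM) p
  anchor_smooth : ∀ X : C^∞⟮𝓘(ℝ, EM), M; 𝓘(ℝ, V), V⟯,
    ContMDiff 𝓘(ℝ, EM) 𝓘(ℝ, EM).tangent ∞
      (fun p : M => (⟨p, anchor p (X p)⟩ : TangentBundle 𝓘(ℝ, EM) M))
  bracket : C^∞⟮𝓘(ℝ, EM), M; 𝓘(ℝ, V), V⟯ → C^∞⟮𝓘(ℝ, EM), M; 𝓘(ℝ, V), V⟯ →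
    C^∞⟮𝓘(ℝ, EM), M; 𝓘(ℝ, V), V⟯
  add_bracket : ∀ X Y Z, bracket (X + Y) Z = bracket X Z + bracket Y Z
  bracket_add : ∀ X Y Z, bracket X (Y + Z) = bracket X Y + bracket X Z
  smul_bracket : ∀ (c : ℝ) X Y, bracket (c • X) Y = c • bracket X Y
  bracket_self : ∀ X, bracket X X = 0
  jacobi : ∀ X Y Z, bracket X (bracket Y Z) = bracket (bracket X Y) Z + bracket Y (bracket X Z)
  leibniz : ∀ (X Y : C^∞⟮𝓘(ℝ, EM), M; 𝓘(ℝ, V), V⟯) (l : C^∞⟮𝓘(ℝ, EM), M; 𝓘(ℝ), ℝ⟯) (p : M),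
    bracket X (l • Y) p = l p • bracket X Y p + covector EM l p (anchor p (X p)) • Y p

variable {EM M V} [IsManifold 𝓘(ℝ, EM) ∞ M]

/-- The constant section of `M × V` with value `v`. -/
def constSection (v : V) : C^∞⟮𝓘(ℝ, EM), M; 𝓘(ℝ, V), V⟯ := ContMDiffMap.const v

variable [FiniteDimensional ℝ V]

variable (EM) in
/-- The differential at `z = (p, δ)` of a function on `M × V*`, as an element of
`T*_p M × V**` with `V** = V`. -/
def dualDifferential (F : M × StrongDual ℝ V → ℝ) (z : M × StrongDual ℝ V) :
    (TangentSpace 𝓘(ℝ, EM) z.1 →L[ℝ] ℝ) × V :=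
  (covector EM (fun q => F (q, z.2)) z.1,
    bidualEquiv.symm (fderiv ℝ (fun δ => F (z.1, δ)) z.2))

namespace LieAlgebroid
variable (A : LieAlgebroid EM M V)

theorem bracket_skew (X Y : C^∞⟮𝓘(ℝ, EM), M; 𝓘(ℝ, V), V⟯) : A.bracket X Y = - A.bracket Y X := by
  have h := A.bracket_self (X + Y)
  rw [A.add_bracket, A.bracket_add, A.bracket_add, A.bracket_self, A.bracket_self, zero_add,
    add_zero] at h
  exact eq_neg_of_add_eq_zero_left h

/-- The linear Poisson bivector on the dual bundle `M × V*`, at `z = (p, δ)`. It gives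
`{X̂, Ŷ} = -[X, Y]^`, `{l ∘ τ, X̂} = (ρ(X) l) ∘ τ` and `{l ∘ τ, k ∘ τ} = 0`: see
`poissonBracket_hat_hat`, `poissonBracket_base_hat` and `poissonBracket_base_base` below. -/
def poissonBivector (z : M × StrongDual ℝ V)
    (φ ψ : (TangentSpace 𝓘(ℝ, EM) z.1 →L[ℝ] ℝ) × V) : ℝ :=
  φ.1 (A.anchor z.1 ψ.2) - ψ.1 (A.anchor z.1 φ.2) -
    z.2 (A.bracket (constSection φ.2) (constSection ψ.2) z.1)

/-- The Poisson bracket `{F, H} = Π(dF, dH)` on the dual bundle `M × V*`. -/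
def poissonBracket (F H : M × StrongDual ℝ V → ℝ) (z : M × StrongDual ℝ V) : ℝ :=
  A.poissonBivector z (dualDifferential EM F z) (dualDifferential EM H z)

/-- The Hamiltonian vector field `X_H`, as the operator `F ↦ {F, H}`. -/
def hamiltonianVectorField (H F : M × StrongDual ℝ V → ℝ) : M × StrongDual ℝ V → ℝ :=
  A.poissonBracket F H

/-- `F` is a first integral of `X_H`: `X_H(F) = {F, H} = 0`. -/
def IsFirstIntegral (H F : M × StrongDual ℝ V → ℝ) : Prop :=
  A.hamiltonianVectorField H F = 0

/-- The fibrewise linear function `X̂` on `M × V*` defined by a section `X` -/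
def hat (X : C^∞⟮𝓘(ℝ, EM), M; 𝓘(ℝ, V), V⟯) (z : M × StrongDual ℝ V) : ℝ := z.2 (X z.1)

/-- `L ∘ X` for a linear form `L`. -/
def compForm (L : StrongDual ℝ V) (X : C^∞⟮𝓘(ℝ, EM), M; 𝓘(ℝ, V), V⟯) :
    C^∞⟮𝓘(ℝ, EM), M; 𝓘(ℝ), ℝ⟯ :=
  ⟨fun q => L (X q), L.contDiff.contMDiff.comp X.contMDiff⟩

theorem covector_comp (X : C^∞⟮𝓘(ℝ, EM), M; 𝓘(ℝ, V), V⟯) (p : M) (u : TangentSpace 𝓘(ℝ, EM) p) :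
    ∃ w : V, ∀ L : StrongDual ℝ V, covector EM (fun q => L (X q)) p u = L w := by
  refine ⟨(mfderiv 𝓘(ℝ, EM) 𝓘(ℝ, V) X p : TangentSpace 𝓘(ℝ, EM) p →L[ℝ] V) u, fun L => ?_⟩
  have h := (L.hasMFDerivAt (x := X p)).comp p
    (X.contMDiff.mdifferentiable (by simp) p).hasMFDerivAt
  exact congrArg (fun D : TangentSpace 𝓘(ℝ, EM) p →L[ℝ] ℝ => D u) h.mfderiv

theorem bracket_apply_right (δ : StrongDual ℝ V) (X Y : C^∞⟮𝓘(ℝ, EM), M; 𝓘(ℝ, V), V⟯) (p : M) :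
    δ (A.bracket X Y p) = δ (A.bracket X (constSection (Y p)) p) +
      covector EM (fun q => δ (Y q)) p (A.anchor p (X p)) := by
  let b := Module.finBasis ℝ V
  let co := fun i => LinearMap.toContinuousLinearMap (b.coord i)
  have key : ∀ Z : C^∞⟮𝓘(ℝ, EM), M; 𝓘(ℝ, V), V⟯, δ (A.bracket X Z p) =
      ∑ i, b.repr (Z p) i * δ (A.bracket X (constSection (b i)) p) +
        covector EM (fun q => δ (Z q)) p (A.anchor p (X p)) := by
    intro Z
    have hZ : Z = ∑ i, compForm (co i) Z • (constSection (b i) : C^∞⟮𝓘(ℝ, EM), M; 𝓘(ℝ, V), V⟯) := by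
      ext q
      have hsum : ∀ s : Finset (Fin (Module.finrank ℝ V)),
          (∑ i ∈ s, compForm (co i) Z • (constSection (b i) : C^∞⟮𝓘(ℝ, EM), M; 𝓘(ℝ, V), V⟯)) q =
          ∑ i ∈ s, b.repr (Z q) i • b i := by
        intro s
        induction s using Finset.induction_on with
        | empty => simp
        | insert a s ha ih =>
          rw [Finset.sum_insert ha, Finset.sum_insert ha, ← ih]; rfl
      rw [hsum, b.sum_repr]
    have hbr : ∀ s : Finset (Fin (Module.finrank ℝ V)),
        δ (A.bracket X (∑ i ∈ s, compForm (co i) Z • constSection (b i)) p) =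
        ∑ i ∈ s, (b.repr (Z p) i * δ (A.bracket X (constSection (b i)) p) +
          covector EM (compForm (co i) Z) p (A.anchor p (X p)) * δ (b i)) := by
      intro s
      induction s using Finset.induction_on with
      | empty =>
        have h0 : A.bracket X 0 = 0 := by
          have := A.bracket_add X 0 0
          rwa [add_zero, left_eq_add] at this
        simp [h0]
      | insert a s ha ih =>
        rw [Finset.sum_insert ha, Finset.sum_insert ha, A.bracket_add, ← ih, ContMDiffMap.coe_add,
          Pi.add_apply, map_add, A.leibniz, map_add, map_smul, map_smul]
        rfl
    have hcov : covector EM (fun q => δ (Z q)) p (A.anchor p (X p)) =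
        ∑ i, covector EM (compForm (co i) Z) p (A.anchor p (X p)) * δ (b i) := by
      obtain ⟨w, hw⟩ := covector_comp Z p (A.anchor p (X p))
      have h1 : ∀ i, covector EM (compForm (co i) Z) p (A.anchor p (X p)) = b.repr w i :=
        fun i => hw (co i)
      rw [hw δ]
      simp only [h1]
      conv_lhs => rw [← b.sum_repr w, map_sum]
      simp
    conv_lhs => rw [hZ]
    rw [hbr, Finset.sum_add_distrib, hcov]
  rw [key Y, key (constSection (Y p))]
  have : covector EM (fun q : M => δ ((constSection (Y p) : C^∞⟮𝓘(ℝ, EM), M; 𝓘(ℝ, V), V⟯) q)) p = 0 := by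
    exact mfderiv_const (I := 𝓘(ℝ, EM)) (I' := 𝓘(ℝ)) (c := δ (Y p))
  have h0 : (0 : TangentSpace 𝓘(ℝ, EM) p →L[ℝ] ℝ) (A.anchor p (X p)) = 0 := rfl
  rw [this, h0, add_zero]
  rfl

theorem bracket_apply (δ : StrongDual ℝ V) (X Y : C^∞⟮𝓘(ℝ, EM), M; 𝓘(ℝ, V), V⟯) (p : M) :
    δ (A.bracket X Y p) = δ (A.bracket (constSection (X p)) (constSection (Y p)) p) +
      covector EM (fun q => δ (Y q)) p (A.anchor p (X p)) -
      covector EM (fun q => δ (X q)) p (A.anchor p (Y p)) := by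
  rw [A.bracket_apply_right, A.bracket_skew X, A.bracket_skew (constSection (X p)),
    ContMDiffMap.coe_neg, ContMDiffMap.coe_neg, Pi.neg_apply, Pi.neg_apply, map_neg, map_neg,
    A.bracket_apply_right δ _ X]
  have h : (constSection (Y p) : C^∞⟮𝓘(ℝ, EM), M; 𝓘(ℝ, V), V⟯) p = Y p := rfl
  rw [h]
  ring

theorem dualDifferential_hat (X : C^∞⟮𝓘(ℝ, EM), M; 𝓘(ℝ, V), V⟯) (z : M × StrongDual ℝ V) :
    dualDifferential EM (hat X) z = (covector EM (fun q => z.2 (X q)) z.1, X z.1) := by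
  refine Prod.ext rfl ?_
  apply bidualEquiv.injective
  have : fderiv ℝ (fun δ : StrongDual ℝ V => hat X (z.1, δ)) z.2 = bidualEquiv (X z.1) :=
    (bidualEquiv (X z.1)).fderiv
  simp [dualDifferential, this]

theorem dualDifferential_base (l : M → ℝ) (z : M × StrongDual ℝ V) :
    dualDifferential EM (fun w : M × StrongDual ℝ V => l w.1) z = (covector EM l z.1, (0 : V)) := by
  refine Prod.ext rfl ?_
  simp [dualDifferential]

theorem poissonBracket_hat_hat (X Y : C^∞⟮𝓘(ℝ, EM), M; 𝓘(ℝ, V), V⟯) (z : M × StrongDual ℝ V) :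
    A.poissonBracket (hat X) (hat Y) z = - hat (A.bracket X Y) z := by
  rw [poissonBracket, dualDifferential_hat, dualDifferential_hat, poissonBivector, hat,
    A.bracket_apply z.2 X Y z.1]
  ring

theorem bracket_zero (X : C^∞⟮𝓘(ℝ, EM), M; 𝓘(ℝ, V), V⟯) : A.bracket X (constSection 0) = 0 := by
  have := A.bracket_add X 0 0
  rwa [add_zero, left_eq_add] at this

theorem poissonBracket_base_hat (l : M → ℝ) (X : C^∞⟮𝓘(ℝ, EM), M; 𝓘(ℝ, V), V⟯)
    (z : M × StrongDual ℝ V) :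
    A.poissonBracket (fun w => l w.1) (hat X) z = covector EM l z.1 (A.anchor z.1 (X z.1)) := by
  rw [poissonBracket, dualDifferential_hat, dualDifferential_base, poissonBivector,
    A.bracket_skew, A.bracket_zero]
  simp

theorem poissonBracket_base_base (l k : M → ℝ) (z : M × StrongDual ℝ V) :
    A.poissonBracket (fun w => l w.1) (fun w => k w.1) z = 0 := by
  rw [poissonBracket, dualDifferential_base, dualDifferential_base, poissonBivector,
    A.bracket_zero]
  simp

end LieAlgebroid
end Algebroid

section CoadjointGroupoid
variable {E : Type*} [NormedAddCommGroup E] [NormedSpace ℝ E] [FiniteDimensional ℝ E]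
  {G : Type*} [TopologicalSpace G] [ChartedSpace E G] [Group G] [LieGroup 𝓘(ℝ, E) ∞ G]
  (ξ : StrongDual ℝ (LieAlg E G))

/-- `Ad*_g ξ` as an element of `O(ξ)`. -/
def orbitPoint (g : G) : coadOrbit ξ := ⟨coAd g ξ, g, rfl⟩

theorem orbitPoint_surjective : Function.Surjective (orbitPoint ξ) := by
  rintro ⟨_, g, rfl⟩
  exact ⟨g, rfl⟩

theorem orbitPoint_eq_iff {a b : G} :
    orbitPoint ξ a = orbitPoint ξ b ↔ b⁻¹ * a ∈ coadStabilizer ξ := by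
  constructor
  · intro h
    have h' : coAd a ξ = coAd b ξ := congrArg Subtype.val h
    show coAd (b⁻¹ * a) ξ = ξ
    rw [coAd_mul, h', ← coAd_mul, inv_mul_cancel, coAd_one]
  · intro h
    have h' : coAd (b⁻¹ * a) ξ = ξ := h
    apply Subtype.ext
    show coAd a ξ = coAd b ξ
    conv_rhs => rw [← h', ← coAd_mul, mul_inv_cancel_left]

/-- The multiplication `(Ad*_a ξ)(Ad*_b ξ) = Ad*_{ab} ξ`. -/
instance : Mul (coadOrbit ξ) where
  mul η ζ := orbitPoint ξ ((orbitPoint_surjective ξ η).choose * (orbitPoint_surjective ξ ζ).choose)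

/-- The unit `Ad*_1 ξ = ξ`. -/
instance : One (coadOrbit ξ) where
  one := orbitPoint ξ 1

/-- The inversion `(Ad*_a ξ)⁻¹ = Ad*_{a⁻¹} ξ`. -/
instance : Inv (coadOrbit ξ) where
  inv η := orbitPoint ξ (orbitPoint_surjective ξ η).choose⁻¹

section Anchor
variable {EM : Type*} [NormedAddCommGroup EM] [NormedSpace ℝ EM]
  {M : Type*} [TopologicalSpace M] [ChartedSpace EM M]

variable (EM M) in
/-- The differential of the target map of `M × O(ξ)` at the unit `(p, ξ)` on the vectors
`(0, σ)`, `σ ∈ T_ξ O(ξ)`, which form the kernel of the differential of the source map. -/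
def coadAnchor (p : M) : CoadTangent ξ →L[ℝ] TangentSpace 𝓘(ℝ, EM) p :=
  (mfderiv (𝓘(ℝ, EM).prod 𝓘(ℝ, StrongDual ℝ (LieAlg E G))) 𝓘(ℝ, EM)
    (fun z : M × StrongDual ℝ (LieAlg E G) => z.1) (p, ξ)).comp
    ((ContinuousLinearMap.inr ℝ (TangentSpace 𝓘(ℝ, EM) p) (StrongDual ℝ (LieAlg E G))).comp
      (coadInclusion ξ))

theorem coadAnchor_apply (p : M) (σ : CoadTangent ξ) : coadAnchor ξ EM M p σ = 0 := by
  have h : mfderiv (𝓘(ℝ, EM).prod 𝓘(ℝ, StrongDual ℝ (LieAlg E G))) 𝓘(ℝ, EM)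
    (fun z : M × StrongDual ℝ (LieAlg E G) => z.1) (p, ξ) = _ := mfderiv_fst
  rw [coadAnchor, h]
  rfl

end Anchor

variable [hN : (coadStabilizer ξ).Normal]

theorem orbitPoint_mul (a b : G) : orbitPoint ξ a * orbitPoint ξ b = orbitPoint ξ (a * b) := by
  have ha := (orbitPoint_eq_iff ξ).1 (orbitPoint_surjective ξ (orbitPoint ξ a)).choose_spec
  have hb := (orbitPoint_eq_iff ξ).1 (orbitPoint_surjective ξ (orbitPoint ξ b)).choose_spec
  refine (orbitPoint_eq_iff ξ).2 ?_
  generalize (orbitPoint_surjective ξ (orbitPoint ξ a)).choose = c at *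
  generalize (orbitPoint_surjective ξ (orbitPoint ξ b)).choose = d at *
  have h := (coadStabilizer ξ).mul_mem (hN.conj_mem _ ha b⁻¹) hb
  convert h using 1
  group

theorem orbitPoint_inv (a : G) : (orbitPoint ξ a)⁻¹ = orbitPoint ξ a⁻¹ := by
  have ha := (orbitPoint_eq_iff ξ).1 (orbitPoint_surjective ξ (orbitPoint ξ a)).choose_spec
  refine (orbitPoint_eq_iff ξ).2 ?_
  generalize (orbitPoint_surjective ξ (orbitPoint ξ a)).choose = c at *
  have h := hN.conj_mem _ ((coadStabilizer ξ).inv_mem ha) a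
  convert h using 1
  group

instance : Group (coadOrbit ξ) :=
  Group.ofLeftAxioms
    (fun η ζ κ => by
      obtain ⟨a, rfl⟩ := orbitPoint_surjective ξ η
      obtain ⟨b, rfl⟩ := orbitPoint_surjective ξ ζ
      obtain ⟨c, rfl⟩ := orbitPoint_surjective ξ κ
      simp only [orbitPoint_mul, mul_assoc])
    (fun η => by
      obtain ⟨a, rfl⟩ := orbitPoint_surjective ξ η
      exact (orbitPoint_mul ξ 1 a).trans (by rw [one_mul]))
    (fun η => by
      obtain ⟨a, rfl⟩ := orbitPoint_surjective ξ η
      rw [orbitPoint_inv, orbitPoint_mul, inv_mul_cancel]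
      rfl)

/-- A groupoid `Γ ⇉ M`. The product `g * h` is defined when the source of `g` is the
target of `h`. -/
structure GroupoidOver (Γ M : Type*) where
  source : Γ → M
  target : Γ → M
  unit : M → Γ
  inv : Γ → Γ
  mul : ∀ g h : Γ, source g = target h → Γ
  source_unit : ∀ p, source (unit p) = p
  target_unit : ∀ p, target (unit p) = p
  source_inv : ∀ g, source (inv g) = target g
  target_inv : ∀ g, target (inv g) = source g
  source_mul : ∀ g h e, source (mul g h e) = source h
  target_mul : ∀ g h e, target (mul g h e) = target g
  mul_assoc : ∀ g h k e e', mul (mul g h e) k ((source_mul g h e).trans e') =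
    mul g (mul h k e') (e.trans (target_mul h k e').symm)
  unit_mul : ∀ g, mul (unit (target g)) g (source_unit _) = g
  mul_unit : ∀ g, mul g (unit (source g)) (target_unit _).symm = g
  inv_mul : ∀ g, mul (inv g) g (source_inv g) = unit (source g)
  mul_inv : ∀ g, mul g (inv g) (target_inv g).symm = unit (target g)

/-- The co-adjoint groupoid `M × O(ξ) ⇉ M`: `Ad*_g ξ` in the fibre over `p` has source and
target `p`, and `(p, Ad*_a ξ) (p, Ad*_b ξ) = (p, Ad*_{ab} ξ)`. -/
def coadGroupoid (M : Type*) : GroupoidOver (M × coadOrbit ξ) M where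
  source := Prod.fst
  target := Prod.fst
  unit p := (p, orbitPoint ξ 1)
  inv g := (g.1, g.2⁻¹)
  mul g h _ := (g.1, g.2 * h.2)
  source_unit _ := rfl
  target_unit _ := rfl
  source_inv _ := rfl
  target_inv _ := rfl
  source_mul _ _ e := e
  target_mul _ _ _ := rfl
  mul_assoc g h k _ _ := Prod.ext rfl (_root_.mul_assoc g.2 h.2 k.2)
  unit_mul g := Prod.ext rfl (one_mul g.2)
  mul_unit g := Prod.ext rfl (mul_one g.2)
  inv_mul g := Prod.ext rfl (inv_mul_cancel g.2)
  mul_inv g := Prod.ext rfl (mul_inv_cancel g.2)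

/-- The bracket of `T_ξ O(ξ)` as a continuous bilinear map. -/
def lieCLM : CoadTangent ξ →L[ℝ] CoadTangent ξ →L[ℝ] CoadTangent ξ :=
  LinearMap.toContinuousLinearMap
    { toFun := fun σ => LinearMap.toContinuousLinearMap
        { toFun := fun τ => ⁅σ, τ⁆
          map_add' := fun τ υ => lie_add σ τ υ
          map_smul' := fun c τ => lie_smul c σ τ }
      map_add' := fun σ τ => by ext1 υ; exact add_lie σ τ υ
      map_smul' := fun c σ => by ext1 υ; exact smul_lie c σ υ }

theorem lieCLM_apply (σ τ : CoadTangent ξ) : lieCLM ξ σ τ = ⁅σ, τ⁆ := rfl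

variable {EM : Type*} [NormedAddCommGroup EM] [NormedSpace ℝ EM]
  (M : Type*) [TopologicalSpace M] [ChartedSpace EM M] [IsManifold 𝓘(ℝ, EM) ∞ M]

/-- The co-adjoint Lie algebroid `A𝒢 = M × T_ξ O(ξ)` of `𝒢 = M × O(ξ)`. -/
def coadAlgebroid : LieAlgebroid EM M (CoadTangent ξ) where
  anchor := coadAnchor ξ EM M
  anchor_smooth X := by
    have h : (fun p : M => (⟨p, coadAnchor ξ EM M p (X p)⟩ : TangentBundle 𝓘(ℝ, EM) M)) =
        fun p => ⟨p, 0⟩ := by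
      funext p; rw [coadAnchor_apply]
    rw [h]
    exact Bundle.contMDiff_zeroSection ℝ (TangentSpace 𝓘(ℝ, EM) (M := M))
  bracket X Y := ⟨fun p => ⁅X p, Y p⁆, by
    have h := ((lieCLM ξ).contDiff (n := ∞)).contMDiff.comp X.contMDiff
    exact h.clm_apply Y.contMDiff⟩
  add_bracket X Y Z := by ext1 p; exact add_lie (X p) (Y p) (Z p)
  bracket_add X Y Z := by ext1 p; exact lie_add (X p) (Y p) (Z p)
  smul_bracket c X Y := by ext1 p; exact smul_lie c (X p) (Y p)
  bracket_self X := by ext1 p; exact lie_self (X p)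
  jacobi X Y Z := by ext1 p; exact leibniz_lie (X p) (Y p) (Z p)
  leibniz X Y l p := by
    rw [coadAnchor_apply, map_zero, zero_smul, add_zero]
    exact lie_smul (l p) (X p) (Y p)

/-- The bracket of the sections `ad*_V ξ` and `ad*_W ξ` is `ad*_{[V, W]} ξ`. -/
theorem coadAlgebroid_bracket (V W : LieAlg E G) :
    (coadAlgebroid ξ (EM := EM) M).bracket (constSection (coadVec ξ V)) (constSection (coadVec ξ W)) =
      constSection (coadVec ξ ⁅V, W⁆) := by
  ext1 p
  exact coadVec_lie ξ V W

/-- The Kirillov–Kostant bracket on `T*_ξ O(ξ)`: `{f, h}(λ) = -⟨λ, [df_λ, dh_λ]⟩`, where the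
differentials lie in `T**_ξ O(ξ) = T_ξ O(ξ)`. -/
def kirillovKostant (f h : StrongDual ℝ (CoadTangent ξ) → ℝ) (δ : StrongDual ℝ (CoadTangent ξ)) : ℝ :=
  - δ ⁅bidualEquiv.symm (fderiv ℝ f δ), bidualEquiv.symm (fderiv ℝ h δ)⁆

/-- The Hamiltonian vector field `X_h`, as the operator `f ↦ {f, h}`. -/
def kkHamiltonianVectorField (h f : StrongDual ℝ (CoadTangent ξ) → ℝ) :
    StrongDual ℝ (CoadTangent ξ) → ℝ :=
  kirillovKostant ξ f h

/-- `f` is a first integral of `X_h`: `X_h(f) = {f, h} = 0`. -/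
def IsKKFirstIntegral (h f : StrongDual ℝ (CoadTangent ξ) → ℝ) : Prop :=
  kkHamiltonianVectorField ξ h f = 0

end CoadjointGroupoid

end

/-! The theorem reduces to a pointwise identity: the bracket of `F` and `H` at `(p, δ)` equals the
Kirillov–Kostant bracket of `f` and `h` at `δ`, whatever the base point `p`. In other words, the
Poisson bracket of two functions pulled back along the projection `M × T*_ξ O(ξ) → T*_ξ O(ξ)` is the
pullback of their bracket. Since `M` is nonempty this projection is surjective, so a pulled-back
function vanishes exactly when the original function does.

The identity comes from the vanishing of the anchor. Source and target of the co-adjoint groupoid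
are the same projection, so the differential of the target kills the kernel of the differential of
the source (`coadAnchor_apply`). Of the three terms of the linear Poisson bivector, the two that
pair a base covector with the anchor disappear. What remains is `-δ` applied to the bracket of the
two fibre differentials. The bivector extends these by constant sections; for a general algebroid
the choice of extension is compensated by the anchor terms (`LieAlgebroid.bracket_apply`). Here the
bracket of sections is pointwise, so its value at `p` is the Lie bracket of `T_ξ O(ξ)`, which is the
one entering the Kirillov–Kostant formula.

The substantial input is that this Lie bracket exists. The formula `[ad*_V ξ, ad*_W ξ] = ad*_{[V,
W]} ξ` is independent of representatives precisely when the kernel of `V ↦ ad*_V ξ` is an ideal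
(`coadVec_lie_eq_zero`), and this is where normality of the stabilizer enters, through
`ideal_local`. For `V` in the kernel, the integral curve through `1` of the right-invariant field of
`V`, read in a chart, stays for small time in the stabilizer of `ξ`. By normality its conjugates by
any `g` do too; differentiating along the curve gives `ξ(Ad_g [V, Z]) = 0` for all `g` and `Z`.
Differentiating once more, in `g` at `1`, gives `ξ([W, [V, Z]]) = 0`, which is the ideal property.
Both differentiations use that the derivative of `Ad` at `1` is the Lie bracket (`fderiv_chartAd`);
this is read off from the second derivatives of the relation `(x y x⁻¹) x = x y` in a chart
(`fderiv_conj_local`). -/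

/-- For functions on `M × T*_ξ O(ξ)` that depend on the fibre variable only, the linear Poisson
bracket is the Kirillov–Kostant bracket: the anchor of the co-adjoint algebroid vanishes. -/
theorem poissonBracket_coadAlgebroid
    {E : Type*} [NormedAddCommGroup E] [NormedSpace ℝ E] [FiniteDimensional ℝ E]
    {G : Type*} [TopologicalSpace G] [ChartedSpace E G] [Group G] [LieGroup 𝓘(ℝ, E) ∞ G]
    (ξ : StrongDual ℝ (LieAlg E G)) [(coadStabilizer ξ).Normal]
    {EM : Type*} [NormedAddCommGroup EM] [NormedSpace ℝ EM]
    {M : Type*} [TopologicalSpace M] [ChartedSpace EM M] [IsManifold 𝓘(ℝ, EM) ∞ M]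
    {f h : StrongDual ℝ (CoadTangent ξ) → ℝ} {F H : M × StrongDual ℝ (CoadTangent ξ) → ℝ}
    (hF : ∀ p δ, F (p, δ) = f δ) (hH : ∀ p δ, H (p, δ) = h δ)
    (p : M) (δ : StrongDual ℝ (CoadTangent ξ)) :
    (coadAlgebroid ξ (EM := EM) M).poissonBracket F H (p, δ) = kirillovKostant ξ f h δ := by
  -- A vector `(0, σ)` tangent to the source fibre is sent to `0` by the differential of the target,
  -- because the target is also the first projection.
  have hanchor (σ : CoadTangent ξ) : (coadAlgebroid ξ (EM := EM) M).anchor p σ = 0 :=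
    coadAnchor_apply ξ p σ
  -- True by definition: sections are bracketed pointwise, and a constant section takes the same
  -- value at `p` as everywhere else. No derivative of a section enters.
  have hbracket (σ τ : CoadTangent ξ) :
      (coadAlgebroid ξ (EM := EM) M).bracket (constSection σ) (constSection τ) p = ⁅σ, τ⁆ := rfl
  -- With the anchor equal to zero, each base covector is evaluated at `0`, so the base derivatives
  -- of `F` and `H` contribute nothing. In the remaining term `hF` and `hH` act under the binder of
  -- the fibre derivative: with `p` frozen, `F (p, ·)` is `f` and `H (p, ·)` is `h`, so the fibre
  -- differentials are those of `f` and `h` at `δ`. Signs and order of arguments agree, since both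
  -- brackets carry the same minus sign.
  simp only [LieAlgebroid.poissonBracket, LieAlgebroid.poissonBivector, dualDifferential,
    hanchor, hbracket, map_zero, sub_self, zero_sub, kirillovKostant, hF, hH]

/-- Vanishing of `X_H(F)` is tested on all pairs `(p, δ)`, vanishing of `X_h(f)` on all `δ`. The
bracket identity makes the first function constant in `p`, with the second as its value, so only the
passage between the two ranges of quantification is left. The first argument of either predicate is
the Hamiltonian, the second the candidate integral. -/
theorem mainTheorem2
    {E : Type*} [NormedAddCommGroup E] [NormedSpace ℝ E] [FiniteDimensional ℝ E]
    {G : Type*} [TopologicalSpace G] [ChartedSpace E G] [Group G] [LieGroup 𝓘(ℝ, E) ∞ G]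
    (ξ : StrongDual ℝ (LieAlg E G)) [(coadStabilizer ξ).Normal]
    {EM : Type*} [NormedAddCommGroup EM] [NormedSpace ℝ EM]
    {M : Type*} [TopologicalSpace M] [ChartedSpace EM M] [IsManifold 𝓘(ℝ, EM) ∞ M] [Nonempty M]
    (h f : C^∞⟮𝓘(ℝ, StrongDual ℝ (CoadTangent ξ)), StrongDual ℝ (CoadTangent ξ); 𝓘(ℝ), ℝ⟯)
    (H F : C^∞⟮(𝓘(ℝ, EM)).prod 𝓘(ℝ, StrongDual ℝ (CoadTangent ξ)),
      M × StrongDual ℝ (CoadTangent ξ); 𝓘(ℝ), ℝ⟯)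
    (hH : ∀ (p : M) (δ : StrongDual ℝ (CoadTangent ξ)), H (p, δ) = h δ)
    (hF : ∀ (p : M) (δ : StrongDual ℝ (CoadTangent ξ)), F (p, δ) = f δ) :
    (coadAlgebroid ξ (EM := EM) M).IsFirstIntegral H F ↔ IsKKFirstIntegral ξ h f := by
  constructor
  · intro hFH
    funext δ
    -- Any base point will do, as the bracket does not depend on it. One is needed: over an empty
    -- base every `F` would be a first integral vacuously, with no information on `f`.
    obtain ⟨p⟩ := ‹Nonempty M›
    exact (poissonBracket_coadAlgebroid ξ hF hH p δ).symm.trans (congrFun hFH (p, δ))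
  · intro hfh
    funext ⟨p, δ⟩
    -- The single equation at `δ` serves every point of `M × {δ}`; this direction holds fibre by
    -- fibre.
    exact (poissonBracket_coadAlgebroid ξ hF hH p δ).trans (congrFun hfh δ)
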